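/- Let $\Gamma$ denote the Gamma function. For every $q\in\tfrac12\mathbb{Z}\setminus\mathbb{Z}_{\le 0}$ (that is, for every real number $q$ such that $2q$ is an integer and $q$ is not a non-positive integer), the elements of the sequence $\{\Gamma^{(n)}(q)\}_{n\ge 1}$ are transcendental infinitely often: there are infinitely many integers $n\ge 1$ for which the $n$-th derivative $\Gamma^{(n)}(q)$ is transcendental over $\mathbb{Q}$. -/

import Mathlib

/-! If only finitely many Γ^(n)(q) were transcendental, all derivatives at q would lie in a finitely
generated module over the real algebraic numbers. This property, `DerivsFinitelySpanned`, survives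
products and, by Γ(s+1) = sΓ(s), integer shifts that avoid the poles, so q may be taken to be 1/2 or
1. There the reflection formula turns Γ(q+x)Γ(q-x) into π/cos(πx) or πx/sin(πx), whose n-th
derivative at 0 is a rational multiple of π^(n+c). Powers of the transcendental number π are
independent, so almost all these derivatives vanish and the function is a polynomial near 0, which
its pole forbids (`not_derivsFinitelySpanned_of_mul_eq`). -/

/-! ### Transcendence of π, by Lindemann's argument -/

open Polynomial in
/-- A Galois-stable multiset of roots of an integer polynomial has, after clearing denominators,
integral sums of values of integer polynomials. -/
theorem exists_int_eq_sum_aeval {K : Type*} [Field K] [Algebra ℚ K] [IsGalois ℚ K]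
    {B : Multiset K} (hB : ∀ g : K ≃ₐ[ℚ] K, B.map g = B) {f : ℤ[X]}
    (hf : ∀ b ∈ B, aeval b f = 0) (P : ℤ[X]) {D : ℕ} (hD : P.natDegree ≤ D) :
    ∃ M : ℤ, (M : K) = (f.leadingCoeff : K) ^ D * (B.map fun b => aeval b P).sum := by
  set y : K := (f.leadingCoeff : K) ^ D * (B.map fun b => aeval b P).sum with hy
  have hint : IsIntegral ℤ y := by
    rw [hy, ← Multiset.sum_map_mul_left]
    refine IsIntegral.multiset_sum fun z hz => ?_
    obtain ⟨b, hb, rfl⟩ := Multiset.mem_map.mp hz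
    have hab : IsIntegral ℤ ((f.leadingCoeff : K) * b) := by
      have := isIntegral_leadingCoeff_smul f b (hf b hb)
      simpa [zsmul_eq_mul] using this
    rw [aeval_eq_sum_range, Finset.mul_sum]
    refine IsIntegral.sum _ fun i hi => ?_
    have hi' : i ≤ D := by
      have := Finset.mem_range.mp hi
      omega
    have : (f.leadingCoeff : K) ^ D * P.coeff i • b ^ i =
        ((f.leadingCoeff ^ (D - i) * P.coeff i : ℤ) : K) * ((f.leadingCoeff : K) * b) ^ i := by
      rw [zsmul_eq_mul, mul_pow, ← Nat.sub_add_cancel hi', pow_add]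
      push_cast
      simp
      ring
    rw [this]
    exact (isIntegral_algebraMap (R := ℤ) (A := K)).mul (hab.pow i)
  have hfix : ∀ g : K ≃ₐ[ℚ] K, g y = y := by
    intro g
    have h1 : (B.map fun b => aeval (g b) P) = B.map fun b => aeval b P := by
      conv_rhs => rw [← hB g, Multiset.map_map]
      rfl
    have h2 : ∀ b, g (aeval b P) = aeval (g b) P := fun b =>
      (aeval_algHom_apply (g.toAlgHom.restrictScalars ℤ) b P).symm
    rw [hy, map_mul, map_pow, map_intCast, map_multiset_sum, Multiset.map_map]
    simp only [Function.comp_def, h2, h1]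
  obtain ⟨x, hx⟩ := (InfiniteGalois.mem_range_algebraMap_iff_fixed (k := ℚ) y).mpr hfix
  rw [← hx] at hint
  have hx' : IsIntegral ℤ x :=
    (isIntegral_algebraMap_iff (algebraMap ℚ K).injective).mp hint
  obtain ⟨M, hM⟩ := IsIntegrallyClosed.isIntegral_iff.mp hx'
  refine ⟨M, ?_⟩
  rw [← hx, ← hM]
  simp

open Polynomial in
/-- A Galois-stable multiset is contained in the roots of an integer polynomial that vanishes
nowhere else. -/
theorem exists_int_polynomial_of_map_eq {K : Type*} [Field K] [Algebra ℚ K] [IsGalois ℚ K]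
    {B : Multiset K} (hB : ∀ g : K ≃ₐ[ℚ] K, B.map g = B) :
    ∃ f : ℤ[X], f ≠ 0 ∧ ∀ b : K, aeval b f = 0 ↔ b ∈ B := by
  set G : K[X] := (B.map fun b => X - C b).prod with hG
  have hlift : G ∈ Polynomial.lifts (algebraMap ℚ K) := by
    rw [Polynomial.lifts_iff_coeff_lifts]
    intro n
    rw [InfiniteGalois.mem_range_algebraMap_iff_fixed]
    intro g
    have : G.map (g : K →+* K) = G := by
      rw [hG, Polynomial.map_multiset_prod, Multiset.map_map]
      conv_rhs => rw [← hB g, Multiset.map_map]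
      simp
    conv_rhs => rw [← this]
    rw [coeff_map]
    rfl
  obtain ⟨G₀, hG₀⟩ := (Polynomial.mem_lifts G).mp hlift
  have hGne : G ≠ 0 := (monic_multiset_prod_of_monic B _ fun b _ => monic_X_sub_C b).ne_zero
  have hG₀ne : G₀ ≠ 0 := by
    rintro rfl
    exact hGne (by rw [← hG₀, Polynomial.map_zero])
  obtain ⟨c, hc, hmap⟩ := IsLocalization.integerNormalization_spec (nonZeroDivisors ℤ) G₀
  have : CharZero K := algebraRat.charZero K
  have hc0 : c ≠ 0 := nonZeroDivisors.ne_zero hc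
  refine ⟨IsLocalization.integerNormalization (nonZeroDivisors ℤ) G₀, ?_, fun b => ?_⟩
  · rwa [Ne, IsFractionRing.integerNormalization_eq_zero_iff]
  · have h1 : aeval b (IsLocalization.integerNormalization (nonZeroDivisors ℤ) G₀) =
        (c : K) * G.eval b := by
      rw [← aeval_map_algebraMap ℚ, hmap, ← hG₀, eval_map_algebraMap]
      simp [zsmul_eq_mul]
    rw [h1, mul_eq_zero, or_iff_right (by exact_mod_cast hc0), ← IsRoot.def, ← mem_roots hGne, hG,
      roots_multiset_prod_X_sub_C]

-- Hermite's method: for a large prime p, each n·exp(b) is very close to p·gp(b), with p not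
-- dividing n. If the sum vanished, clearing denominators would give an integer `a ^ (p * m) * n * k
-- + p * M` of absolute value below 1, hence zero, although p does not divide its first term.
open Polynomial Filter Topology in
theorem natCast_add_sum_exp_ne_zero {K : Type*} [Field K] [Algebra ℚ K] [IsGalois ℚ K]
    (ι : K →ₐ[ℚ] ℂ) {B : Multiset K} (hB : ∀ g : K ≃ₐ[ℚ] K, B.map g = B) (h0 : (0 : K) ∉ B)
    {k : ℕ} (hk : k ≠ 0) : (k : ℂ) + (B.map fun b => Complex.exp (ι b)).sum ≠ 0 := by
  intro hsum
  obtain ⟨f, hf, hroot⟩ := exists_int_polynomial_of_map_eq hB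
  have hf0 : f.eval 0 ≠ 0 := by
    intro h
    apply h0
    rw [← hroot, ← coeff_zero_eq_aeval_zero', coeff_zero_eq_eval_zero, h, map_zero]
  obtain ⟨c, hc⟩ := LindemannWeierstrass.exp_polynomial_approx f hf0
  set a := f.leadingCoeff with ha
  have ha0 : a ≠ 0 := leadingCoeff_ne_zero.mpr hf
  set m := f.natDegree with hm
  set A : ℝ := |(a : ℝ)| ^ m * |c| with hA
  have hlim : Tendsto (fun n : ℕ => B.card * (A * (A ^ n / n.factorial))) atTop (𝓝 0) := by
    simpa using ((FloorSemiring.tendsto_pow_div_factorial_atTop A).const_mul A).const_mul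
      (B.card : ℝ)
  obtain ⟨n₀, hn₀⟩ := eventually_atTop.mp (hlim.eventually_lt_const one_pos)
  -- Beyond `n₀` the error is below 1; |f(0)| is required by `hc`; exceeding |a| and k keeps p from
  -- dividing them.
  obtain ⟨p, hpge, hp⟩ := Nat.exists_infinite_primes
    (n₀ + (f.eval 0).natAbs + a.natAbs + k + 2)
  obtain ⟨n, hpn, gp, hgp, happ⟩ := hc p (by omega) hp
  obtain ⟨M, hM⟩ := exists_int_eq_sum_aeval hB (fun b hb => (hroot b).mpr hb) gp
    (D := p * m) (by omega)
  have hMC : (M : ℂ) = (a : ℂ) ^ (p * m) * (B.map fun b => aeval (ι b) gp).sum := by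
    have := congrArg ι hM
    rw [map_intCast, map_mul, map_pow, map_intCast, map_multiset_sum, Multiset.map_map] at this
    rw [this]
    congr 3
    funext b
    exact (aeval_algHom_apply (ι.restrictScalars ℤ) b gp).symm
  set S : ℂ := (B.map fun b => n • Complex.exp (ι b) - p • aeval (ι b) gp).sum with hS
  have hN : ((a ^ (p * m) * n * k + p * M : ℤ) : ℂ) = -(a : ℂ) ^ (p * m) * S := by
    have hS' : S = n * (B.map fun b => Complex.exp (ι b)).sum
        - p * (B.map fun b => aeval (ι b) gp).sum := by
      rw [hS, Multiset.sum_map_sub]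
      simp only [zsmul_eq_mul, nsmul_eq_mul, Multiset.sum_map_mul_left]
    rw [hS', eq_neg_of_add_eq_zero_right hsum]
    push_cast
    rw [hMC]
    ring
  have hSle : ‖S‖ ≤ B.card * (|c| ^ p / (p - 1).factorial) := by
    rw [hS]
    refine (norm_multiset_sum_le _).trans ?_
    rw [Multiset.map_map, ← nsmul_eq_mul]
    have := Multiset.sum_le_card_nsmul
      (B.map ((fun x => ‖x‖) ∘ fun b => n • Complex.exp (ι b) - p • aeval (ι b) gp))
      (|c| ^ p / (p - 1).factorial) ?_
    · simpa only [Multiset.card_map] using this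
    · intro x hx
      obtain ⟨b, hb, rfl⟩ := Multiset.mem_map.mp hx
      refine (happ (r := ι b) ?_).trans ?_
      · rw [mem_aroots]
        refine ⟨hf, ?_⟩
        have := aeval_algHom_apply (ι.restrictScalars ℤ) b f
        simp only [AlgHom.coe_restrictScalars'] at this
        rw [this, (hroot b).mpr hb, map_zero]
      · rw [← abs_pow]
        gcongr
        exact le_abs_self _
  have hlt : ‖((a ^ (p * m) * n * k + p * M : ℤ) : ℂ)‖ < 1 := by
    rw [hN, norm_mul, norm_neg, norm_pow, Complex.norm_intCast]
    refine lt_of_le_of_lt (mul_le_mul_of_nonneg_left hSle (by positivity)) ?_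
    refine lt_of_eq_of_lt ?_ (hn₀ (p - 1) (by omega))
    have hAp : A * A ^ (p - 1) = |(a : ℝ)| ^ (p * m) * |c| ^ p := by
      rw [← pow_succ', Nat.sub_add_cancel hp.one_le, hA, mul_pow, ← pow_mul, mul_comm m p]
    rw [← mul_div_assoc A, hAp]
    ring
  have hzero : a ^ (p * m) * n * k + p * M = 0 := by
    rw [Complex.norm_intCast] at hlt
    exact Int.abs_lt_one_iff.mp (by exact_mod_cast hlt)
  have hdvd : (p : ℤ) ∣ a ^ (p * m) * n * k := by
    rw [eq_neg_of_add_eq_zero_left hzero]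
    exact (dvd_mul_right _ _).neg_right
  have hpZ := Nat.prime_iff_prime_int.mp hp
  rcases hpZ.dvd_or_dvd hdvd with h | h
  · rcases hpZ.dvd_or_dvd h with h | h
    · have := Int.natAbs_dvd_natAbs.mpr (hpZ.dvd_of_dvd_pow h)
      have := Nat.le_of_dvd (Int.natAbs_pos.mpr ha0) this
      simp at this
      omega
    · exact hpn h
  · have := Nat.le_of_dvd (Nat.pos_of_ne_zero hk) (Int.natCast_dvd_natCast.mp h)
    omega

-- The product of 1 + exp(ι x) over the conjugates x of t would vanish. Expanded, it is the sum of
-- exponentials of the subset sums, a Galois-stable multiset; the zero sums, among them that of the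
-- empty set, contribute the positive integer k.
open Polynomial in
theorem exp_ne_neg_one_of_isGalois {K : Type*} [Field K] [Algebra ℚ K] [IsGalois ℚ K]
    (ι : K →ₐ[ℚ] ℂ) (t : K) : Complex.exp (ι t) ≠ -1 := by
  classical
  intro hexp
  have htint : IsIntegral ℚ t := (Algebra.IsAlgebraic.isAlgebraic t).isIntegral
  set T : Finset K := ((minpoly ℚ t).aroots K).toFinset with hT
  have hmem : ∀ x, x ∈ T ↔ aeval x (minpoly ℚ t) = 0 := fun x => by
    rw [hT, Multiset.mem_toFinset, mem_aroots, and_iff_right (minpoly.ne_zero htint)]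
  have himg : ∀ g : K ≃ₐ[ℚ] K, T.image g = T := fun g => by
    refine Finset.eq_of_subset_of_card_le (fun x hx => ?_)
      (Finset.card_image_of_injective _ g.injective).ge
    obtain ⟨y, hy, rfl⟩ := Finset.mem_image.mp hx
    rw [hmem] at hy ⊢
    have := aeval_algHom_apply g.toAlgHom y (minpoly ℚ t)
    simp only [AlgEquiv.toAlgHom_apply] at this
    rw [this, hy, map_zero]
  set B₀ : Multiset K := T.powerset.val.map fun S => ∑ x ∈ S, x with hB₀
  have hB₀map : ∀ g : K ≃ₐ[ℚ] K, B₀.map g = B₀ := fun g => by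
    have hpow : T.powerset.val.map (fun S => S.image g) = T.powerset.val := by
      have hinj : Set.InjOn (fun S : Finset K => S.image g) T.powerset :=
        (Finset.image_injective g.injective).injOn
      rw [← Finset.image_val_of_injOn hinj, ← Finset.powerset_image, himg]
    conv_rhs => rw [hB₀, ← hpow, Multiset.map_map]
    rw [hB₀, Multiset.map_map]
    refine Multiset.map_congr rfl fun S _ => ?_
    simp [Finset.sum_image g.injective.injOn]
  have hsum : (B₀.map fun b => Complex.exp (ι b)).sum = 0 := by
    have hprod : ∏ x ∈ T, (1 + Complex.exp (ι x)) = 0 :=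
      Finset.prod_eq_zero ((hmem t).mpr (minpoly.aeval ℚ t)) (by rw [hexp]; ring)
    rw [Finset.prod_one_add] at hprod
    rw [← hprod, hB₀, Multiset.map_map]
    refine Finset.sum_congr rfl fun S _ => ?_
    simp [Complex.exp_sum]
  have hB : ∀ g : K ≃ₐ[ℚ] K, (B₀.filter (· ≠ 0)).map g = B₀.filter (· ≠ 0) := fun g => by
    conv_rhs => rw [← hB₀map g, Multiset.filter_map]
    simp
  have hk : (B₀.filter fun b => ¬ b ≠ 0).card ≠ 0 := by
    refine (Multiset.card_pos_iff_exists_mem.mpr ⟨0, Multiset.mem_filter.mpr ⟨Multiset.mem_map.mpr ⟨∅, ?_, Finset.sum_empty⟩, by simp⟩⟩).ne'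
    exact Finset.empty_mem_powerset T
  refine natCast_add_sum_exp_ne_zero ι hB (by simp) hk ?_
  rw [← hsum]
  conv_rhs => rw [← Multiset.filter_add_not (fun b : K => b ≠ 0) B₀, Multiset.map_add,
    Multiset.sum_add, add_comm]
  congr 1
  rw [Multiset.map_congr (g := fun _ => (1 : ℂ)) rfl fun x hx => ?_]
  · simp
  · have : x = 0 := by simpa using (Multiset.mem_filter.mp hx).2
    simp [this]

theorem transcendental_pi : Transcendental ℚ Real.pi := by
  intro h
  have hπ : IsAlgebraic ℚ (Real.pi : ℂ) := h.algebraMap (A := ℂ)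
  have hI : IsAlgebraic ℚ Complex.I := by
    refine IsIntegral.isAlgebraic ⟨Polynomial.X ^ 2 + 1, by monicity!, by simp⟩
  exact exp_ne_neg_one_of_isGalois (algebraicClosure ℚ ℂ).val
    ⟨_, mem_algebraicClosure_iff.mpr (hπ.mul hI)⟩ Complex.exp_pi_mul_I

/-! ### Functions with finitely spanned derivatives -/

/-- All iterated derivatives of `f` at `x` lie in one finite-dimensional space over the real
algebraic numbers. -/
def DerivsFinitelySpanned (f : ℝ → ℝ) (x : ℝ) : Prop :=
  ∃ V : Submodule (algebraicClosure ℚ ℝ) ℝ, V.FG ∧ ∀ n, iteratedDeriv n f x ∈ V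

theorem finite_setOf_pow_add_mem {x : ℝ} (hx : Transcendental ℚ x)
    {W : Submodule (algebraicClosure ℚ ℝ) ℝ} (hW : W.FG) (c : ℕ) :
    {n : ℕ | x ^ (n + c) ∈ W}.Finite := by
  have htr : Transcendental (algebraicClosure ℚ ℝ) x := hx.algebraicClosure
  have hli : LinearIndependent (algebraicClosure ℚ ℝ) fun n : ℕ => x ^ n := by
    have := (Polynomial.basisMonomials (algebraicClosure ℚ ℝ)).linearIndependent.map'
      (Polynomial.aeval x).toLinearMap
      (LinearMap.ker_eq_bot.mpr (transcendental_iff_injective.mp htr))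
    simpa [Function.comp_def] using this
  set s := {n : ℕ | x ^ (n + c) ∈ W} with hs
  have hli' : LinearIndependent (algebraicClosure ℚ ℝ) fun n : s => x ^ ((n : ℕ) + c) :=
    hli.comp (fun n : s => (n : ℕ) + c) fun a b hab => Subtype.ext (Nat.add_right_cancel hab)
  have hli'' : LinearIndependent (algebraicClosure ℚ ℝ)
      fun n : s => (⟨x ^ ((n : ℕ) + c), n.2⟩ : W) :=
    LinearIndependent.of_comp W.subtype hli'
  have : Module.Finite (algebraicClosure ℚ ℝ) W := Module.Finite.iff_fg.mpr hW
  exact Set.finite_coe_iff.mp hli''.finite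

theorem derivsFinitelySpanned_of_finite {f : ℝ → ℝ} {x : ℝ}
    (h : {n : ℕ | 1 ≤ n ∧ Transcendental ℚ (iteratedDeriv n f x)}.Finite) :
    DerivsFinitelySpanned f x := by
  set s := {n : ℕ | 1 ≤ n ∧ Transcendental ℚ (iteratedDeriv n f x)} with hs
  refine ⟨Submodule.span _ (insert 1 (insert (f x) ((fun n => iteratedDeriv n f x) '' s))),
    Submodule.fg_span (((h.image _).insert _).insert _), fun n => ?_⟩
  by_cases hn : n ∈ s
  · exact Submodule.subset_span (Or.inr (Or.inr ⟨n, hn, rfl⟩))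
  · rcases Nat.eq_zero_or_pos n with rfl | hpos
    · exact Submodule.subset_span (Or.inr (Or.inl (by simp)))
    · have halg : IsAlgebraic ℚ (iteratedDeriv n f x) := by
        by_contra hcon
        exact hn ⟨hpos, hcon⟩
      have h1 : (1 : ℝ) ∈ Submodule.span (algebraicClosure ℚ ℝ)
          (insert 1 (insert (f x) ((fun n => iteratedDeriv n f x) '' s))) :=
        Submodule.subset_span (Set.mem_insert _ _)
      have := Submodule.smul_mem _
        (⟨_, mem_algebraicClosure_iff.mpr halg⟩ : algebraicClosure ℚ ℝ) h1
      simpa [IntermediateField.smul_def] using this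

theorem DerivsFinitelySpanned.comp_const_add {f : ℝ → ℝ} {a x : ℝ}
    (h : DerivsFinitelySpanned f (a + x)) : DerivsFinitelySpanned (fun y => f (a + y)) x := by
  obtain ⟨V, hV, hmem⟩ := h
  exact ⟨V, hV, fun n => by simpa [iteratedDeriv_comp_const_add] using hmem n⟩

theorem DerivsFinitelySpanned.comp_neg {f : ℝ → ℝ} {x : ℝ}
    (h : DerivsFinitelySpanned f (-x)) : DerivsFinitelySpanned (fun y => f (-y)) x := by
  obtain ⟨V, hV, hmem⟩ := h
  refine ⟨V, hV, fun n => ?_⟩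
  rw [iteratedDeriv_comp_neg]
  rcases neg_one_pow_eq_or ℝ n with h | h
  · simpa [h] using hmem n
  · simpa [h] using hmem n

theorem DerivsFinitelySpanned.mul {f g : ℝ → ℝ} {x : ℝ} (hf : AnalyticAt ℝ f x)
    (hg : AnalyticAt ℝ g x) (h : DerivsFinitelySpanned f x) (h' : DerivsFinitelySpanned g x) :
    DerivsFinitelySpanned (f * g) x := by
  obtain ⟨V, hV, hmem⟩ := h
  obtain ⟨V', hV', hmem'⟩ := h'
  refine ⟨V * V', hV.mul hV', fun n => ?_⟩
  rw [iteratedDeriv_mul hf.contDiffAt hg.contDiffAt]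
  refine Submodule.sum_mem _ fun i _ => ?_
  rw [mul_assoc, ← nsmul_eq_mul]
  exact Submodule.smul_of_tower_mem _ _ (Submodule.mul_mem_mul (hmem i) (hmem' (n - i)))

/-! ### Quotients with a pole and rational multiples of powers of π -/

/-- Division of Taylor series whose `n`-th derivatives are rational multiples of powers of `x`. -/
theorem exists_rat_iteratedDeriv_of_mul {F h : ℝ → ℝ} {x : ℝ} (hx : x ≠ 0)
    (hF : AnalyticAt ℝ F 0) (hh : AnalyticAt ℝ h 0) {m c : ℕ}
    (hlow : ∀ i < m, iteratedDeriv i h 0 = 0) (hm : iteratedDeriv m h 0 ≠ 0)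
    (hrat : ∀ n, ∃ r : ℚ, iteratedDeriv n h 0 = r * x ^ n)
    (hprod : ∀ n, ∃ r : ℚ, iteratedDeriv n (F * h) 0 = r * x ^ (n + c)) (n : ℕ) :
    ∃ r : ℚ, iteratedDeriv n F 0 = r * x ^ (n + c) := by
  choose r hr using hrat
  choose s hs using hprod
  induction n using Nat.strong_induction_on with
  | _ n ih =>
    choose! t ht using ih
    have hL := hs (n + m)
    -- Leibniz terms with i > n contain a derivative of `h` of order below m and vanish, so the term
    -- i = n is the last one and determines the n-th derivative of `F`.
    rw [iteratedDeriv_mul hF.contDiffAt hh.contDiffAt,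
      ← Finset.sum_subset (s₁ := Finset.range (n + 1)) (by
        intro i hi
        rw [Finset.mem_range] at hi ⊢
        omega) (by
        intro i hi hi'
        rw [Finset.mem_range] at hi hi'
        rw [hlow _ (by omega), mul_zero]),
      Finset.sum_range_succ, Nat.add_sub_cancel_left] at hL
    have hsum : ∑ i ∈ Finset.range n, ((n + m).choose i : ℝ) * iteratedDeriv i F 0 *
        iteratedDeriv (n + m - i) h 0 =
        ((∑ i ∈ Finset.range n, (n + m).choose i * t i * r (n + m - i) : ℚ) : ℝ) *
          x ^ (n + m + c) := by
      push_cast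
      rw [Finset.sum_mul]
      refine Finset.sum_congr rfl fun i hi => ?_
      have hi' := Finset.mem_range.mp hi
      rw [ht i hi', hr, show n + m + c = (i + c) + (n + m - i) by omega, pow_add]
      ring
    rw [hsum, hr m] at hL
    set σ : ℚ := ∑ i ∈ Finset.range n, (n + m).choose i * t i * r (n + m - i)
    have hrm : (r m : ℝ) ≠ 0 := fun h0 => hm (by rw [hr m, h0, zero_mul])
    have hch : ((n + m).choose n : ℝ) ≠ 0 := by
      exact_mod_cast (Nat.choose_pos (Nat.le_add_right n m)).ne'
    refine ⟨(s (n + m) - σ) / ((n + m).choose n * r m), ?_⟩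
    have key : ((n + m).choose n : ℝ) * r m * x ^ m * iteratedDeriv n F 0 =
        (s (n + m) - σ) * x ^ (n + m + c) := by linear_combination hL
    have hxm : x ^ m ≠ 0 := pow_ne_zero _ hx
    push_cast
    rw [div_mul_eq_mul_div, eq_div_iff (mul_ne_zero hch hrm)]
    refine mul_right_cancel₀ hxm ?_
    rw [show n + m + c = (n + c) + m by omega, pow_add] at key
    linear_combination key

/-- An analytic function whose high derivatives vanish at `0` agrees with a polynomial near `0`. -/
theorem AnalyticAt.exists_polynomial_eventuallyEq {F : ℝ → ℝ} (hF : AnalyticAt ℝ F 0) {N : ℕ}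
    (h : ∀ n, N ≤ n → iteratedDeriv n F 0 = 0) :
    ∃ P : Polynomial ℝ, F =ᶠ[nhds 0] fun x => P.eval x := by
  refine ⟨∑ n ∈ Finset.range N, Polynomial.monomial n (iteratedDeriv n F 0 / n.factorial), ?_⟩
  filter_upwards [hF.hasFPowerSeriesAt.eventually_hasSum] with y hy
  have hy' := hy.unique (hasSum_sum_of_ne_finset_zero (s := Finset.range N) fun n hn => by
    rw [FormalMultilinearSeries.ofScalars_apply_eq, h n (by simpa using hn)]
    simp)
  rw [zero_add] at hy'
  rw [hy', Polynomial.eval_finsetSum]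
  refine Finset.sum_congr rfl fun n _ => ?_
  simp [mul_comm]

/-- `F` would be a polynomial P near 0, so P·h = w on the whole line by the identity theorem, which
fails at `z`. -/
theorem not_derivsFinitelySpanned_of_mul_eq {F h w : ℝ → ℝ} (hF : AnalyticAt ℝ F 0)
    (hh : ∀ x, AnalyticAt ℝ h x) (hw : ∀ x, AnalyticAt ℝ w x) (hFh : F * h =ᶠ[nhds 0] w)
    {m c : ℕ} (hlow : ∀ i < m, iteratedDeriv i h 0 = 0) (hm : iteratedDeriv m h 0 ≠ 0)
    (hrat : ∀ n, ∃ r : ℚ, iteratedDeriv n h 0 = r * Real.pi ^ n)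
    (hwrat : ∀ n, ∃ r : ℚ, iteratedDeriv n w 0 = r * Real.pi ^ (n + c))
    {z : ℝ} (hz : h z = 0) (hwz : w z ≠ 0) : ¬ DerivsFinitelySpanned F 0 := by
  rintro ⟨W, hW, hmem⟩
  have hFrat := exists_rat_iteratedDeriv_of_mul Real.pi_ne_zero hF (hh 0) hlow hm hrat
    (c := c) fun n => by rw [hFh.iteratedDeriv_eq]; exact hwrat n
  have hfin := finite_setOf_pow_add_mem transcendental_pi hW c
  obtain ⟨N, hN⟩ := hfin.bddAbove
  have hzero : ∀ n, N + 1 ≤ n → iteratedDeriv n F 0 = 0 := by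
    intro n hn
    obtain ⟨r, hr⟩ := hFrat n
    by_contra hne
    have hr0 : (r : ℝ) ≠ 0 := fun h0 => hne (by rw [hr, h0, zero_mul])
    have : Real.pi ^ (n + c) ∈ W := by
      have := Submodule.smul_of_tower_mem W r⁻¹ (hmem n)
      rw [hr, Rat.smul_def] at this
      push_cast at this
      rwa [inv_mul_cancel_left₀ hr0] at this
    have := hN this
    omega
  obtain ⟨P, hP⟩ := hF.exists_polynomial_eventuallyEq hzero
  have heq : (fun x => P.eval x * h x) = w := by
    refine AnalyticOnNhd.eq_of_eventuallyEq (𝕜 := ℝ) (z₀ := 0) (fun x _ => ?_) (fun x _ => hw x) ?_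
    · exact (AnalyticOnNhd.eval_polynomial P x (Set.mem_univ x)).mul (hh x)
    · filter_upwards [hFh, hP] with y hy hy'
      rw [← hy, Pi.mul_apply, hy']
  exact hwz (by simp [← heq, hz])

/-! ### The Gamma function: shifts and reflection -/

theorem Real.analyticAt_Gamma {s : ℝ} (hs : ∀ m : ℕ, s ≠ -m) : AnalyticAt ℝ Real.Gamma s := by
  have h1 : AnalyticAt ℂ (fun z : ℂ => (Complex.Gamma z)⁻¹) s :=
    Complex.differentiable_one_div_Gamma.analyticAt _
  have h2 := (h1.inv (inv_ne_zero (Complex.Gamma_ne_zero fun m h => hs m (by exact_mod_cast h))))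
  simp only [Pi.inv_def, inv_inv] at h2
  have h3 := h2.re_ofReal
  simpa [Complex.Gamma_ofReal] using h3

theorem Real.iteratedDeriv_Gamma_add_one {s : ℝ} (hs : ∀ m : ℕ, s ≠ -m) (n : ℕ) :
    iteratedDeriv n Real.Gamma (s + 1) =
      s * iteratedDeriv n Real.Gamma s + n * iteratedDeriv (n - 1) Real.Gamma s := by
  have hs0 : s ≠ 0 := by simpa using hs 0
  have h1 : (fun x => Real.Gamma (x + 1)) =ᶠ[nhds s] (fun x => x) * Real.Gamma := by
    filter_upwards [eventually_ne_nhds hs0] with x hx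
    exact Real.Gamma_add_one hx
  have h2 := h1.iteratedDeriv_eq n
  rw [iteratedDeriv_comp_add_const, iteratedDeriv_mul contDiffAt_fun_id
    (Real.analyticAt_Gamma hs).contDiffAt] at h2
  refine h2.trans ?_
  -- Derivatives of the identity of order at least 2 vanish, leaving two Leibniz terms; for n = 0
  -- the truncated `n - 1` has coefficient 0.
  rcases n with _ | n
  · simp
  · rw [Finset.sum_range_succ', Finset.sum_range_succ', Finset.sum_eq_zero]
    · simp [iteratedDeriv_fun_id]
      ring
    · intro i _
      simp [iteratedDeriv_fun_id]

theorem DerivsFinitelySpanned.Gamma_add_one {s : ℝ} (hs : ∀ m : ℕ, s ≠ -m) (hrat : ∃ r : ℚ, s = r)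
    (h : DerivsFinitelySpanned Real.Gamma s) : DerivsFinitelySpanned Real.Gamma (s + 1) := by
  obtain ⟨V, hV, hmem⟩ := h
  obtain ⟨r, rfl⟩ := hrat
  refine ⟨V, hV, fun n => ?_⟩
  rw [Real.iteratedDeriv_Gamma_add_one hs, ← Rat.smul_def, ← nsmul_eq_mul]
  exact V.add_mem (V.smul_of_tower_mem _ (hmem _)) (V.smul_of_tower_mem _ (hmem _))

/-- As s is a nonzero rational, the recurrence can be solved for the n-th derivative at s, so by
induction the same `V` works. -/
theorem DerivsFinitelySpanned.of_Gamma_add_one {s : ℝ} (hs : ∀ m : ℕ, s ≠ -m)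
    (hrat : ∃ r : ℚ, s = r) (h : DerivsFinitelySpanned Real.Gamma (s + 1)) :
    DerivsFinitelySpanned Real.Gamma s := by
  obtain ⟨V, hV, hmem⟩ := h
  obtain ⟨r, rfl⟩ := hrat
  have hr0 : (r : ℝ) ≠ 0 := by simpa using hs 0
  refine ⟨V, hV, fun n => ?_⟩
  have key : ∀ n, iteratedDeriv n Real.Gamma (r : ℝ) = r⁻¹ •
      (iteratedDeriv n Real.Gamma ((r : ℝ) + 1) - n • iteratedDeriv (n - 1) Real.Gamma (r : ℝ)) := by
    intro n
    rw [Real.iteratedDeriv_Gamma_add_one hs, Rat.smul_def, nsmul_eq_mul]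
    push_cast
    field_simp
    ring
  induction n with
  | zero =>
    rw [key]
    exact V.smul_of_tower_mem _ (V.sub_mem (hmem _) (by simp))
  | succ n ih =>
    rw [key]
    exact V.smul_of_tower_mem _ (V.sub_mem (hmem _) (V.smul_of_tower_mem _ ih))

theorem exists_rat_iteratedDeriv_cos_mul (a : ℝ) (n : ℕ) :
    ∃ r : ℚ, iteratedDeriv n (fun x => Real.cos (a * x)) 0 = r * a ^ n := by
  rw [iteratedDeriv_comp_const_mul Real.contDiff_cos]
  simp only [mul_zero]
  rcases Nat.even_or_odd' n with ⟨k, rfl | rfl⟩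
  · exact ⟨(-1) ^ k, by simp [mul_comm (a ^ _)]⟩
  · exact ⟨0, by simp⟩

theorem exists_rat_iteratedDeriv_sin_mul (a : ℝ) (n : ℕ) :
    ∃ r : ℚ, iteratedDeriv n (fun x => Real.sin (a * x)) 0 = r * a ^ n := by
  rw [iteratedDeriv_comp_const_mul Real.contDiff_sin]
  simp only [mul_zero]
  rcases Nat.even_or_odd' n with ⟨k, rfl | rfl⟩
  · exact ⟨0, by simp⟩
  · exact ⟨(-1) ^ k, by simp [mul_comm (a ^ _)]⟩

theorem DerivsFinitelySpanned.Gamma_mul_Gamma {q : ℝ} (hq : ∀ m : ℕ, q ≠ -m)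
    (h : DerivsFinitelySpanned Real.Gamma q) :
    AnalyticAt ℝ ((fun x => Real.Gamma (q + x)) * fun x => Real.Gamma (q + -x)) 0 ∧
    DerivsFinitelySpanned ((fun x => Real.Gamma (q + x)) * fun x => Real.Gamma (q + -x)) 0 := by
  have ha := Real.analyticAt_Gamma hq
  have h1 : AnalyticAt ℝ (fun x => Real.Gamma (q + x)) 0 :=
    AnalyticAt.fun_comp (g := Real.Gamma) (by simpa using ha) (by fun_prop)
  have h2 : AnalyticAt ℝ (fun x => Real.Gamma (q + -x)) 0 :=
    AnalyticAt.fun_comp (g := Real.Gamma) (by simpa using ha) (by fun_prop)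
  have h3 : DerivsFinitelySpanned (fun x => Real.Gamma (q + x)) 0 :=
    DerivsFinitelySpanned.comp_const_add (by simpa using h)
  have h4 : DerivsFinitelySpanned (fun x => Real.Gamma (q + -x)) 0 :=
    DerivsFinitelySpanned.comp_neg (f := fun x => Real.Gamma (q + x)) (by simpa using h3)
  exact ⟨h1.mul h2, h3.mul h1 h2 h4⟩

theorem not_derivsFinitelySpanned_Gamma_half : ¬ DerivsFinitelySpanned Real.Gamma (1 / 2) := by
  intro h
  obtain ⟨ha, hs⟩ := h.Gamma_mul_Gamma fun m hm => by
    have : (0 : ℝ) ≤ m := m.cast_nonneg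
    linarith
  -- Γ(1/2+x)Γ(1/2-x)·cos(πx) = π.
  refine not_derivsFinitelySpanned_of_mul_eq (h := fun x => Real.cos (Real.pi * x))
    (w := fun _ => Real.pi) (m := 0) (c := 1) (z := 1 / 2) ha
    (fun x => by fun_prop) (fun x => by fun_prop) ?_ (by simp) (by simp)
    (exists_rat_iteratedDeriv_cos_mul _) (fun n => ?_) (by simp [← div_eq_mul_inv])
    Real.pi_ne_zero hs
  · have hcont : ContinuousAt (fun x => Real.cos (Real.pi * x)) 0 := by fun_prop
    filter_upwards [hcont.eventually_ne (by simp : Real.cos (Real.pi * 0) ≠ 0)] with x hx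
    have hr := Real.Gamma_mul_Gamma_one_sub (1 / 2 + x)
    rw [show Real.pi * (1 / 2 + x) = Real.pi * x + Real.pi / 2 by ring, Real.sin_add_pi_div_two,
      show (1 : ℝ) - (1 / 2 + x) = 1 / 2 + -x by ring] at hr
    simp only [Pi.mul_apply]
    rw [hr, div_mul_cancel₀ _ hx]
  · rcases n with _ | n
    · exact ⟨1, by simp⟩
    · exact ⟨0, by simp [iteratedDeriv_const]⟩

theorem not_derivsFinitelySpanned_Gamma_one : ¬ DerivsFinitelySpanned Real.Gamma 1 := by
  intro h
  obtain ⟨ha, hs⟩ := h.Gamma_mul_Gamma fun m hm => by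
    have : (0 : ℝ) ≤ m := m.cast_nonneg
    linarith
  -- Γ(1+x)Γ(1-x)·sin(πx) = πx; here m = 1 because the sine has a simple zero at 0.
  refine not_derivsFinitelySpanned_of_mul_eq (h := fun x => Real.sin (Real.pi * x))
    (w := fun x => Real.pi * x) (m := 1) (c := 0) (z := 1) ha
    (fun x => by fun_prop) (fun x => by fun_prop) ?_ ?_ ?_
    (exists_rat_iteratedDeriv_sin_mul _) (fun n => ?_) (by simp) (by simp [Real.pi_ne_zero]) hs
  · have hball : ∀ᶠ x in nhds (0 : ℝ), x ∈ Set.Ioo (-1 : ℝ) 1 :=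
      Ioo_mem_nhds (by norm_num) (by norm_num)
    filter_upwards [hball] with x hx
    rcases eq_or_ne x 0 with rfl | hx0
    · simp
    have hr := Real.Gamma_mul_Gamma_one_sub x
    have hsin : Real.sin (Real.pi * x) ≠ 0 := by
      rw [Ne, Real.sin_eq_zero_iff_of_lt_of_lt]
      · exact mul_ne_zero Real.pi_ne_zero hx0
      · nlinarith [Real.pi_pos, hx.1]
      · nlinarith [Real.pi_pos, hx.2]
    simp only [Pi.mul_apply]
    rw [add_comm, Real.Gamma_add_one hx0, ← sub_eq_add_neg, mul_assoc, mul_assoc,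
      ← mul_assoc (Real.Gamma x), hr, div_mul_cancel₀ _ hsin, mul_comm]
  · intro i hi
    obtain rfl : i = 0 := by omega
    simp
  · rw [iteratedDeriv_comp_const_mul Real.contDiff_sin]
    simp [Real.pi_ne_zero]
  · rw [iteratedDeriv_const_mul_field]
    rcases n with _ | _ | n
    · exact ⟨0, by simp⟩
    · exact ⟨1, by simp [iteratedDeriv_fun_id]⟩
    · exact ⟨0, by simp [iteratedDeriv_fun_id]⟩

/-! ### Passage to all half-integers and positive integers -/

theorem not_derivsFinitelySpanned_Gamma_half_add_int (k : ℤ) :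
    ¬ DerivsFinitelySpanned Real.Gamma (1 / 2 + k) := by
  have hne : ∀ (k : ℤ) (m : ℕ), (1 / 2 + k : ℝ) ≠ -m := by
    intro k m h
    have : (1 : ℝ) + 2 * k = -2 * m := by linarith
    have : (1 : ℤ) + 2 * k = -2 * m := by exact_mod_cast this
    omega
  have hrat : ∀ k : ℤ, ∃ r : ℚ, (1 / 2 + k : ℝ) = r := fun k => ⟨1 / 2 + k, by push_cast; rfl⟩
  induction k using Int.induction_on with
  | zero => simpa using not_derivsFinitelySpanned_Gamma_half
  | succ i ih =>
    intro h
    refine ih (DerivsFinitelySpanned.of_Gamma_add_one (hne _) (hrat _) ?_)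
    convert h using 1
    push_cast
    ring
  | pred i ih =>
    intro h
    apply ih
    convert h.Gamma_add_one (hne _) (hrat _) using 1
    push_cast
    ring

theorem not_derivsFinitelySpanned_Gamma_one_add_nat (k : ℕ) :
    ¬ DerivsFinitelySpanned Real.Gamma (1 + k) := by
  induction k with
  | zero => simpa using not_derivsFinitelySpanned_Gamma_one
  | succ i ih =>
    intro h
    refine ih (DerivsFinitelySpanned.of_Gamma_add_one (fun m hm => ?_)
      ⟨1 + i, by push_cast; rfl⟩ ?_)
    · have : (0 : ℝ) ≤ m := m.cast_nonneg
      have : (0 : ℝ) ≤ i := i.cast_nonneg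
      linarith
    · convert h using 1
      push_cast
      ring

theorem theorem1 (q : ℝ) (hq : ∃ k : ℤ, q = (k : ℝ) / 2) (hq0 : ∀ m : ℤ, m ≤ 0 → q ≠ (m : ℝ)) :
    {n : ℕ | 1 ≤ n ∧ Transcendental ℚ (iteratedDeriv n Real.Gamma q)}.Infinite := by
  intro hfin
  have h := derivsFinitelySpanned_of_finite hfin
  obtain ⟨k, rfl⟩ := hq
  rcases Int.even_or_odd' k with ⟨j, rfl | rfl⟩
  · have hj : 0 < j := by
      by_contra hj
      exact hq0 j (by omega) (by push_cast; ring)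
    obtain ⟨i, hi⟩ := Int.eq_ofNat_of_zero_le (show 0 ≤ j - 1 by omega)
    obtain rfl : j = 1 + i := by omega
    refine not_derivsFinitelySpanned_Gamma_one_add_nat i ?_
    convert h using 1
    push_cast
    ring
  · refine not_derivsFinitelySpanned_Gamma_half_add_int j ?_
    convert h using 1
    push_cast
    ring
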